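/- **Setting.** Let $\ell^2$ be the complex Hilbert space of square summable sequences indexed by $n=0,1,2,\dots$, with standard orthonormal basis $\{e_n\}_{n\ge 0}$. For a bounded sequence $\lambda=\{\lambda_n\}_{n\ge 0}$ of positive real numbers, the unilateral weighted shift $W_\lambda$ is the bounded operator on $\ell^2$ with $W_\lambda e_n=\lambda_n e_{n+1}$ for all $n\ge 0$; the unilateral shift is the case $\lambda_n=1$ for all $n$. Put $\hat\lambda_n=\lambda_0^2\cdots\lambda_{n-1}^2$ (with $\hat\lambda_0=1$). A bounded operator $T$ on a Hilbert space $H$ is *subnormal* if there are a Hilbert space $K$ containing $H$ isometrically and a bounded normal operator $N$ on $K$ with $Th=Nh$ for all $h\in H$. It is *conditionally positive definite* (CPD) if for every $h\in H$ the sequence $\gamma_n=\|T^nh\|^2$ satisfies $\sum_{i,j=0}^k\gamma_{i+j}c_i\bar c_j\ge 0$ for all $k\ge 0$ and all $c_0,\dots,c_k\in\mathbb C$ with $\sum_{j=0}^k c_j=0$. A bounded operator $A$ on $H$ is a *quasi-affine transform* of a bounded operator $B$ on $K$ if there is a bounded linear operator $X\colon H\to K$ that is injective, has dense range and satisfies $XA=BX$.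 Let $Q_0=Q_1=0$ and $Q_n(x)=\sum_{j=0}^{n-2}(n-j-1)x^j$ for $n\ge 2$. The *scalar representing triplet* of a CPD shift $W_\lambda$ is the (unique) triplet $(b,c,\nu)$ with $b\in\mathbb R$, $c\ge 0$ and $\nu$ a compactly supported finite positive Borel measure on $[0,\infty)$ with $\nu(\{1\})=0$ such that $$\hat\lambda_n=1+bn+cn^2+\int_{[0,\infty)}Q_n\,d\nu\qquad(n\ge 0).$$ A CPD shift $W_\lambda$ is of *type I* if $\nu=0$ and $c=0$, and of *type II* if $\operatorname{supp}\nu=\{0\}$ and $c=0$. **Proposition.** If $W_\lambda$ is a CPD unilateral weighted shift that is not subnormal, then $W_\lambda$ is a quasi-affine transform of every subnormal unilateral weighted shift $W_\omega$ with $\|W_\omega\|\le 1$. The unilateral shift is one of these contractive subnormal shifts; in particular $W_\lambda$ is a quasi-affine transform of the unilateral shift. Moreover, every subnormal unilateral weighted shift $W_\lambda$ of type I or of type II satisfies $\|W_\lambda\|=1$. -/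

import Mathlib

open scoped ComplexOrder ComplexConjugate NNReal ENNReal
open MeasureTheory

noncomputable section

/-! ### Bounded operators on Hilbert spaces -/

/-- A real sequence `γ` is conditionally positive definite if
`∑_{i,j=0}^k γ_{i+j} c_i conj(c_j) ≥ 0` for all finite complex sequences `c_0, …, c_k` with
`∑_{j=0}^k c_j = 0`. (For complex `z`, `0 ≤ z` says that `z` is real and nonnegative.) -/
def IsCPDSeq (γ : ℕ → ℝ) : Prop :=
  ∀ (k : ℕ) (c : ℕ → ℂ), ∑ j ∈ Finset.range (k + 1), c j = 0 →
    0 ≤ ∑ i ∈ Finset.range (k + 1), ∑ j ∈ Finset.range (k + 1),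
      ((γ (i + j) : ℝ) : ℂ) * c i * conj (c j)

/-- `T` is conditionally positive definite if `n ↦ ‖T ^ n h‖ ^ 2` is so for every vector `h`. -/
def IsCPD {H : Type*} [NormedAddCommGroup H] [InnerProductSpace ℂ H] [CompleteSpace H]
    (T : H →L[ℂ] H) : Prop :=
  ∀ h : H, IsCPDSeq fun n => ‖(T ^ n) h‖ ^ 2

/-- `T` is subnormal if it extends to a normal operator `N` on a Hilbert space `K` in which `H`
is isometrically embedded. -/
def IsSubnormal.{u} {H : Type u} [NormedAddCommGroup H] [InnerProductSpace ℂ H] [CompleteSpace H]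
    (T : H →L[ℂ] H) : Prop :=
  ∃ (K : Type u) (_ : NormedAddCommGroup K) (_ : InnerProductSpace ℂ K) (_ : CompleteSpace K)
    (V : H →ₗᵢ[ℂ] K) (N : K →L[ℂ] K), IsStarNormal N ∧ ∀ h : H, V (T h) = N (V h)

/-- `A` is a quasi-affine transform of `B` if `X A = B X` for some bounded linear `X` that is
injective and has dense range. -/
def IsQuasiAffineTransform {H K : Type*}
    [NormedAddCommGroup H] [InnerProductSpace ℂ H] [CompleteSpace H]
    [NormedAddCommGroup K] [InnerProductSpace ℂ K] [CompleteSpace K]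
    (A : H →L[ℂ] H) (B : K →L[ℂ] K) : Prop :=
  ∃ X : H →L[ℂ] K, Function.Injective X ∧ DenseRange X ∧ X ∘L A = B ∘L X

/-! ### Unilateral weighted shifts -/

/-- The Hilbert space of square summable complex sequences indexed by `0, 1, 2, …`. -/
abbrev EllTwo : Type := lp (fun _ : ℕ => ℂ) 2

/-- Weights of a unilateral weighted shift: a bounded sequence of positive real numbers. -/
structure ShiftWeights where
  wt : ℕ → ℝ
  pos : ∀ n, 0 < wt n
  bdd : BddAbove (Set.range wt)

/-- The sequence `(0, λ_0 x_0, λ_1 x_1, …)`. -/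
def shiftFun (w x : ℕ → ℂ) : ℕ → ℂ
  | 0 => 0
  | n + 1 => w n * x n

theorem shiftFun_memℓp (l : ShiftWeights) (x : EllTwo) :
    Memℓp (E := fun _ : ℕ => ℂ) (shiftFun (fun n => (l.wt n : ℂ)) x) 2 := by
  obtain ⟨C, hC⟩ := l.bdd
  apply memℓp_gen
  rw [← summable_nat_add_iff 1]
  have hx := (memℓp_gen_iff (p := 2) (by norm_num)).1 (lp.memℓp x)
  refine Summable.of_nonneg_of_le (fun n => by positivity) (fun n => ?_) (hx.mul_left (C ^ 2))
  have h1 : l.wt n ≤ C := hC ⟨n, rfl⟩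
  have h0 := (l.pos n).le
  simp only [shiftFun, norm_mul, Complex.norm_real, Real.norm_eq_abs, abs_of_nonneg h0,
    ENNReal.toReal_ofNat, Real.rpow_ofNat, mul_pow]
  gcongr

/-- The linear map `(x_0, x_1, …) ↦ (0, λ_0 x_0, λ_1 x_1, …)` on `ℓ²`. -/
def weightedShiftLM (l : ShiftWeights) : EllTwo →ₗ[ℂ] EllTwo where
  toFun x := ⟨shiftFun (fun n => (l.wt n : ℂ)) x, shiftFun_memℓp l x⟩
  map_add' x y := by
    ext n
    cases n with
    | zero => exact (add_zero (0 : ℂ)).symm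
    | succ n => exact mul_add (l.wt n : ℂ) (x n) (y n)
  map_smul' a x := by
    ext n
    cases n with
    | zero => exact (mul_zero a).symm
    | succ n => exact mul_left_comm (l.wt n : ℂ) a (x n)

theorem weightedShiftLM_bound (l : ShiftWeights) :
    ∃ C : ℝ, ∀ x : EllTwo, ‖weightedShiftLM l x‖ ≤ C * ‖x‖ := by
  obtain ⟨C, hC⟩ := l.bdd
  have hC0 : 0 ≤ C := (l.pos 0).le.trans (hC ⟨0, rfl⟩)
  refine ⟨C, fun x => ?_⟩
  have h2 : (0 : ℝ) < (2 : ℝ≥0∞).toReal := by norm_num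
  have hx := lp.hasSum_norm h2 x
  have hy := lp.hasSum_norm h2 (weightedShiftLM l x)
  have hy' := (hasSum_nat_add_iff' 1).2 hy
  have key : ‖weightedShiftLM l x‖ ^ 2 ≤ C ^ 2 * ‖x‖ ^ 2 := by
    have := hasSum_le (fun n => ?_) hy' (hx.mul_left (C ^ 2))
    · simpa [weightedShiftLM, shiftFun] using this
    · have h1 : l.wt n ≤ C := hC ⟨n, rfl⟩
      have h0 := (l.pos n).le
      simp only [weightedShiftLM, LinearMap.coe_mk, AddHom.coe_mk, shiftFun, norm_mul,
        Complex.norm_real, Real.norm_eq_abs, abs_of_nonneg h0, ENNReal.toReal_ofNat,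
        Real.rpow_ofNat, mul_pow]
      gcongr
  rw [← mul_pow] at key
  exact le_of_sq_le_sq key (by positivity)

/-- The unilateral weighted shift `W_λ` on `ℓ²` with weights `λ`; see `weightedShift_single`. -/
def weightedShift (l : ShiftWeights) : EllTwo →L[ℂ] EllTwo :=
  (weightedShiftLM l).mkContinuousOfExistsBound (weightedShiftLM_bound l)

/-- `W_λ e_n = λ_n e_{n+1}`, where `e_n` is the standard orthonormal basis of `ℓ²`. -/
theorem weightedShift_single (l : ShiftWeights) (n : ℕ) :
    weightedShift l (lp.single 2 n (1 : ℂ)) = (l.wt n : ℂ) • lp.single 2 (n + 1) (1 : ℂ) := by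
  ext m
  rw [lp.coeFn_smul, Pi.smul_apply]
  cases m with
  | zero => simp [weightedShift, weightedShiftLM, shiftFun]
  | succ m =>
    by_cases h : m = n
    · subst h; simp [weightedShift, weightedShiftLM, shiftFun]
    · simp [weightedShift, weightedShiftLM, shiftFun, h]

/-- The weights of the unilateral shift: `λ_n = 1` for all `n`. -/
def oneWeights : ShiftWeights where
  wt _ := 1
  pos _ := one_pos
  bdd := ⟨1, by rintro _ ⟨n, rfl⟩; exact le_rfl⟩

/-- The unilateral shift. -/
def unilateralShift : EllTwo →L[ℂ] EllTwo := weightedShift oneWeights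

/-- The formal moment sequence: `1` for `n = 0` and `λ_0² ⋯ λ_{n-1}²` for `n ≥ 1`. -/
def ShiftWeights.moment (l : ShiftWeights) (n : ℕ) : ℝ := ∏ i ∈ Finset.range n, l.wt i ^ 2

/-! ### Scalar representing triplets and types of shifts -/

/-- `Q_0 = Q_1 = 0` and `Q_n(x) = ∑_{j=0}^{n-2} (n - j - 1) x^j` for `n ≥ 2`. -/
def cpdQ (n : ℕ) (x : ℝ) : ℝ := ∑ j ∈ Finset.range (n - 1), ((n : ℝ) - j - 1) * x ^ j

/-- `(b, c, ν)` is the scalar representing triplet of `W_λ`: `b` is real, `c ≥ 0`, `ν` is a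
compactly supported finite Borel measure on `[0, ∞)` with `ν {1} = 0`, and
`λ̂_n = 1 + b n + c n² + ∫ Q_n dν` for all `n`. -/
structure IsScalarRepresentingTriplet (l : ShiftWeights) (b c : ℝ) (ν : Measure ℝ≥0) :
    Prop where
  c_nonneg : 0 ≤ c
  finite : IsFiniteMeasure ν
  compact_support : IsCompact ν.support
  one_null : ν {1} = 0
  moment_eq : ∀ n : ℕ,
    l.moment n = 1 + b * n + c * (n : ℝ) ^ 2 + ∫ x : ℝ≥0, cpdQ n (x : ℝ) ∂ν

/-- The CPD weighted shift `W_λ` is of type I: `ν = 0` and `c = 0`. -/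
def ShiftWeights.IsTypeI (l : ShiftWeights) : Prop :=
  IsCPD (weightedShift l) ∧
    ∃ (b c : ℝ) (ν : Measure ℝ≥0), IsScalarRepresentingTriplet l b c ν ∧ ν = 0 ∧ c = 0

/-- The CPD weighted shift `W_λ` is of type II: `supp ν = {0}` and `c = 0`. -/
def ShiftWeights.IsTypeII (l : ShiftWeights) : Prop :=
  IsCPD (weightedShift l) ∧
    ∃ (b c : ℝ) (ν : Measure ℝ≥0), IsScalarRepresentingTriplet l b c ν ∧ ν.support = {0} ∧ c = 0

end

/-! ### Weighted shifts on basis vectors -/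

/-! A diagonal operator intertwines two weighted shifts when its squared entries are the ratios of
their moments, and it is bounded once these ratios are. A contractive shift has moments at most 1,
so it suffices that the moments of the CPD shift stay away from 0.

CPD makes these moments convex, so otherwise they decrease to 0. Then the shift is subnormal: for
the functional `L` with these moments, CPD says `L (x^m (1 - x)^2 |p|^2) ≥ 0`, and decay lets both
factors `1 - x` be cancelled. The GNS construction gives `B ≥ 0` with `⟨v, B^n v⟩` equal to the
moments, and the shift sits inside a normal bilateral shift with operator weight `√B`.

For types I and II the moments are affine from index 1 on, while subnormality makes them log-convex;
this forces slope 0, so all weights after the first equal 1. -/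

theorem ShiftWeights.moment_pos (l : ShiftWeights) (n : ℕ) : 0 < l.moment n :=
  Finset.prod_pos fun i _ => pow_pos (l.pos i) 2

theorem ShiftWeights.moment_succ (l : ShiftWeights) (n : ℕ) :
    l.moment (n + 1) = l.moment n * l.wt n ^ 2 := Finset.prod_range_succ _ _

theorem EllTwo.clm_ext {E : Type*} [NormedAddCommGroup E] [NormedSpace ℂ E] {f g : EllTwo →L[ℂ] E}
    (h : ∀ n, f (lp.single 2 n 1) = g (lp.single 2 n 1)) : f = g :=
  lp.ext_continuousLinearMap (by simp) fun n => ContinuousLinearMap.ext_ring (h n)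

theorem norm_weightedShift_single (l : ShiftWeights) (n : ℕ) :
    ‖weightedShift l (lp.single 2 n (1 : ℂ))‖ = l.wt n := by
  rw [weightedShift_single, norm_smul, lp.norm_single (by norm_num)]
  simp [abs_of_pos (l.pos n)]

theorem moment_mul_norm_sq_weightedShift_pow_single (l : ShiftWeights) (m n : ℕ) :
    l.moment m * ‖(weightedShift l ^ n) (lp.single 2 m (1 : ℂ))‖ ^ 2 = l.moment (n + m) := by
  induction n generalizing m with
  | zero => simp [lp.norm_single]
  | succ n ih =>
    have h : (n + 1 + m) = n + (m + 1) := by ring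
    rw [pow_succ (weightedShift l), mul_apply_eq_comp, weightedShift_single, map_smul, norm_smul, mul_pow,
      h, ← ih, l.moment_succ]
    simp
    ring

theorem wt_le_norm_weightedShift (l : ShiftWeights) (n : ℕ) : l.wt n ≤ ‖weightedShift l‖ := by
  rw [← norm_weightedShift_single]
  refine ((weightedShift l).le_opNorm _).trans_eq ?_
  rw [lp.norm_single (by norm_num)]
  simp

theorem norm_weightedShift_le (l : ShiftWeights) {C : ℝ} (hC : ∀ n, l.wt n ≤ C) :
    ‖weightedShift l‖ ≤ C := by
  have hC0 : 0 ≤ C := (l.pos 0).le.trans (hC 0)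
  refine ContinuousLinearMap.opNorm_le_bound _ hC0 fun x => ?_
  have h2 : (0 : ℝ) < (2 : ℝ≥0∞).toReal := by norm_num
  have hx := lp.hasSum_norm h2 x
  have hy' := (hasSum_nat_add_iff' 1).2 (lp.hasSum_norm h2 (weightedShiftLM l x))
  have key : ‖weightedShiftLM l x‖ ^ 2 ≤ C ^ 2 * ‖x‖ ^ 2 := by
    have := hasSum_le (fun n => ?_) hy' (hx.mul_left (C ^ 2))
    · simpa [weightedShiftLM, shiftFun] using this
    · have h1 := hC n
      have h0 := (l.pos n).le
      simp only [weightedShiftLM, LinearMap.coe_mk, AddHom.coe_mk, shiftFun, norm_mul,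
        Complex.norm_real, Real.norm_eq_abs, abs_of_nonneg h0, ENNReal.toReal_ofNat,
        Real.rpow_ofNat, mul_pow]
      gcongr
  rw [← mul_pow] at key
  exact le_of_sq_le_sq key (by positivity)

theorem ShiftWeights.moment_le_one (l : ShiftWeights) (h : ‖weightedShift l‖ ≤ 1) (n : ℕ) :
    l.moment n ≤ 1 :=
  Finset.prod_le_one (fun _ _ => sq_nonneg _) fun i _ =>
    pow_le_one₀ (l.pos i).le ((wt_le_norm_weightedShift l i).trans h)

/-! ### Intertwining by diagonal operators -/

/-- Intertwining forces the diagonal entries up to a scalar. Positive entries give injectivity, and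
the range is dense since it contains every finitely supported sequence. -/
theorem isQuasiAffineTransform_of_moment_le {l w : ShiftWeights} {C : ℝ}
    (h : ∀ n, w.moment n ≤ C * l.moment n) :
    IsQuasiAffineTransform (weightedShift l) (weightedShift w) := by
  set a : ℕ → ℝ := fun n => √(w.moment n / l.moment n) with ha
  have ha0 : ∀ n, 0 < a n := fun n => Real.sqrt_pos.2 (div_pos (w.moment_pos n) (l.moment_pos n))
  have haC : ∀ n, ‖(a n : ℂ) • ContinuousLinearMap.id ℂ ℂ‖ ≤ √C := fun n => by
    rw [norm_smul, ContinuousLinearMap.norm_id, mul_one, Complex.norm_real, Real.norm_eq_abs,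
      abs_of_pos (ha0 n)]
    exact Real.sqrt_le_sqrt ((div_le_iff₀ (l.moment_pos n)).2 (h n))
  have hrec : ∀ n, a (n + 1) * l.wt n = w.wt n * a n := fun n => by
    have h1 : w.moment (n + 1) / l.moment (n + 1)
        = (w.moment n / l.moment n) * (w.wt n / l.wt n) ^ 2 := by
      rw [w.moment_succ, l.moment_succ, div_pow, div_mul_div_comm]
    have h2 := (l.pos n).ne'
    simp only [ha]
    rw [h1, Real.sqrt_mul (div_pos (w.moment_pos n) (l.moment_pos n)).le,
      Real.sqrt_sq (div_pos (w.pos n) (l.pos n)).le]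
    field_simp
  let X : EllTwo →L[ℂ] EllTwo := lp.mapCLM 2 _ (Real.sqrt_nonneg C) haC
  have hX : ∀ (x : EllTwo) n, X x n = a n * x n := fun x n => rfl
  have hXs : ∀ n z, X (lp.single 2 n z) = (a n : ℂ) • lp.single 2 n z := fun n z => by
    ext m
    rw [hX, lp.coeFn_smul, Pi.smul_apply]
    by_cases h : m = n
    · subst h; rfl
    · simp [h]
  refine ⟨X, fun x y hxy => ?_, ?_, ?_⟩
  · ext n
    have := congrArg (fun z : EllTwo => z n) hxy
    simp only [hX] at this
    exact mul_left_cancel₀ (Complex.ofReal_ne_zero.2 (ha0 n).ne') this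
  · intro y
    have hs := lp.hasSum_single (p := 2) (by simp) y
    refine mem_closure_of_tendsto hs (Filter.Eventually.of_forall fun s => ?_)
    refine ⟨∑ i ∈ s, (a i : ℂ)⁻¹ • lp.single 2 i (y i), ?_⟩
    rw [map_sum]
    refine Finset.sum_congr rfl fun i _ => ?_
    rw [map_smul, hXs, inv_smul_smul₀ (Complex.ofReal_ne_zero.2 (ha0 i).ne')]
  · refine EllTwo.clm_ext fun n => ?_
    simp only [ContinuousLinearMap.comp_apply, weightedShift_single, map_smul, hXs, smul_smul]
    congr 1
    exact_mod_cast (mul_comm _ _).trans ((hrec n).trans (mul_comm _ _))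

/-! ### Subnormal shifts have nondecreasing weights -/

/-- Cauchy–Schwarz for `⟨N* N k, k⟩`, together with `‖N* N k‖ = ‖N N k‖` for normal `N`. -/
theorem norm_sq_le_of_isSubnormal {H : Type*} [NormedAddCommGroup H] [InnerProductSpace ℂ H]
    [CompleteSpace H] {T : H →L[ℂ] H} (hT : IsSubnormal T) (h : H) :
    ‖T h‖ ^ 2 ≤ ‖T (T h)‖ * ‖h‖ := by
  obtain ⟨K, _, _, _, V, N, hN, hV⟩ := hT
  rw [← V.norm_map (T h), ← V.norm_map (T (T h)), ← V.norm_map h, hV, hV, hV]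
  set k := V h
  have h1 : ‖ContinuousLinearMap.adjoint N (N k)‖ = ‖N (N k)‖ :=
    (ContinuousLinearMap.isStarNormal_iff_norm_eq_adjoint.1 hN (N k)).symm
  calc ‖N k‖ ^ 2 = RCLike.re (inner ℂ (N k) (N k)) := (inner_self_eq_norm_sq _).symm
    _ = RCLike.re (inner ℂ (ContinuousLinearMap.adjoint N (N k)) k) := by
        rw [ContinuousLinearMap.adjoint_inner_left]
    _ ≤ ‖ContinuousLinearMap.adjoint N (N k)‖ * ‖k‖ := re_inner_le_norm _ _
    _ = ‖N (N k)‖ * ‖k‖ := by rw [h1]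

theorem wt_le_wt_succ_of_isSubnormal {l : ShiftWeights} (hl : IsSubnormal (weightedShift l))
    (n : ℕ) : l.wt n ≤ l.wt (n + 1) := by
  have h := norm_sq_le_of_isSubnormal hl (lp.single 2 n 1)
  rw [norm_weightedShift_single, weightedShift_single, map_smul, norm_smul,
    norm_weightedShift_single, lp.norm_single (by norm_num), Complex.norm_real, Real.norm_eq_abs,
    abs_of_pos (l.pos n), norm_one, mul_one, sq] at h
  exact le_of_mul_le_mul_left h (l.pos n)

/-- Affinity is asked only from index 1 on, because in type II the integral term vanishes at both 0
and 1. -/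
theorem norm_weightedShift_eq_one_of_moment_affine {l : ShiftWeights}
    (hl : IsSubnormal (weightedShift l)) {α β : ℝ} (h : ∀ n, l.moment (n + 1) = α + β * n) :
    ‖weightedShift l‖ = 1 := by
  have hmono : Monotone l.wt := monotone_nat_of_le_succ (wt_le_wt_succ_of_isSubnormal hl)
  have h0 := h 0
  have h1 := h 1
  have h2 := h 2
  have p0 := l.moment_pos 1
  have p1 := l.moment_pos 2
  have e1 : l.moment 2 = l.moment 1 * l.wt 1 ^ 2 := l.moment_succ 1
  have e2 : l.moment 3 = l.moment 2 * l.wt 2 ^ 2 := l.moment_succ 2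
  have hle : l.wt 1 ^ 2 ≤ l.wt 2 ^ 2 := pow_le_pow_left₀ (l.pos 1).le (hmono (by norm_num)) 2
  norm_num at h0 h1 h2
  have hβ : β = 0 := by
    -- Log-convexity reads `(α + β)^2 ≤ α (α + 2β)`, that is, `β^2 ≤ 0`.
    have : l.moment 2 * l.moment 2 ≤ l.moment 3 * l.moment 1 := by
      rw [e2]
      nth_rewrite 2 [e1]
      have := mul_le_mul_of_nonneg_left hle (mul_pos p1 p0).le
      linarith
    rw [h0, h1, h2] at this
    nlinarith [sq_nonneg β]
  have hone : ∀ n, l.wt (n + 1) = 1 := fun n => by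
    have hs := l.moment_succ (n + 1)
    rw [h, h, hβ, zero_mul, zero_mul, add_zero] at hs
    have hα : α ≠ 0 := by linarith
    have : l.wt (n + 1) ^ 2 = 1 := mul_left_cancel₀ hα (by linarith)
    exact (pow_eq_one_iff_of_nonneg (l.pos _).le two_ne_zero).1 this
  refine le_antisymm (norm_weightedShift_le l fun n => ?_) ?_
  · exact (hmono n.le_succ).trans_eq (hone n)
  · exact (hone 0).symm.le.trans (wt_le_norm_weightedShift l 1)

theorem norm_weightedShift_eq_one_of_type {l : ShiftWeights}
    (hl : IsSubnormal (weightedShift l)) (h : l.IsTypeI ∨ l.IsTypeII) :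
    ‖weightedShift l‖ = 1 := by
  rcases h with ⟨-, b, c, ν, ht, rfl, rfl⟩ | ⟨-, b, c, ν, ht, hν, rfl⟩
  · refine norm_weightedShift_eq_one_of_moment_affine hl (α := 1 + b) (β := b) fun n => ?_
    rw [ht.moment_eq]
    push_cast
    simp
    ring
  · refine norm_weightedShift_eq_one_of_moment_affine hl (α := 1 + b) (β := b + ν.real Set.univ)
      fun n => ?_
    have hae : ∀ᵐ x : ℝ≥0 ∂ν, cpdQ (n + 1) x = n := by
      filter_upwards [Measure.support_mem_ae (μ := ν)] with x hx
      rw [hν, Set.mem_singleton_iff] at hx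
      subst hx
      cases n with
      | zero => simp [cpdQ]
      | succ n => simp [cpdQ, Finset.sum_range_succ']
    rw [ht.moment_eq, integral_congr_ae hae, integral_const]
    push_cast
    simp
    ring

/-! ### A criterion for subnormality -/

section BilateralShift

theorem memℓp_comp_add {M : Type*} [NormedAddCommGroup M] (d : ℤ) {x : ℤ → M} (hx : Memℓp x 2) :
    Memℓp (fun k => x (k + d)) 2 := by
  have h2 : 0 < (2 : ℝ≥0∞).toReal := by norm_num
  rw [memℓp_gen_iff h2] at hx ⊢
  exact (Equiv.addRight d).summable_iff.2 hx

variable {M : Type*} [NormedAddCommGroup M] [InnerProductSpace ℂ M]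

/-- The translation `(x_k) ↦ (x_{k+d})` of `ℓ²(ℤ, M)`. -/
noncomputable def translation (M : Type*) [NormedAddCommGroup M] [InnerProductSpace ℂ M] (d : ℤ) :
    lp (fun _ : ℤ => M) 2 →ₗᵢ[ℂ] lp (fun _ : ℤ => M) 2 where
  toFun x := ⟨fun k => x (k + d), memℓp_comp_add d (lp.memℓp x)⟩
  map_add' _ _ := rfl
  map_smul' _ _ := rfl
  norm_map' x := by
    have h2 : 0 < (2 : ℝ≥0∞).toReal := by norm_num
    rw [lp.norm_eq_tsum_rpow h2, lp.norm_eq_tsum_rpow h2]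
    congr 1
    exact (Equiv.addRight d).tsum_eq fun k => ‖x k‖ ^ (2 : ℝ≥0∞).toReal

/-- The operator `(x_k) ↦ (A x_{k+d})` on `ℓ²(ℤ, M)`. -/
noncomputable def bilateralShift (A : M →L[ℂ] M) (d : ℤ) :
    lp (fun _ : ℤ => M) 2 →L[ℂ] lp (fun _ : ℤ => M) 2 :=
  lp.mapCLM 2 (fun _ => A) (norm_nonneg A) (fun _ => le_rfl) ∘L
    (translation M d).toContinuousLinearMap

theorem bilateralShift_apply (A : M →L[ℂ] M) (d : ℤ) (x : lp (fun _ : ℤ => M) 2) (k : ℤ) :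
    bilateralShift A d x k = A (x (k + d)) := rfl

theorem adjoint_bilateralShift [CompleteSpace M] (A : M →L[ℂ] M) (d : ℤ) :
    ContinuousLinearMap.adjoint (bilateralShift A d)
      = bilateralShift (ContinuousLinearMap.adjoint A) (-d) := by
  refine ((ContinuousLinearMap.eq_adjoint_iff _ _).2 fun x y => ?_).symm
  rw [lp.inner_eq_tsum, lp.inner_eq_tsum]
  simp only [bilateralShift_apply, ContinuousLinearMap.adjoint_inner_left]
  rw [← (Equiv.addRight d).tsum_eq]
  simp

theorem isStarNormal_bilateralShift [CompleteSpace M] {A : M →L[ℂ] M} (hA : IsStarNormal A) (d : ℤ) :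
    IsStarNormal (bilateralShift A d) := by
  refine ⟨?_⟩
  rw [ContinuousLinearMap.star_eq_adjoint, adjoint_bilateralShift]
  ext x k
  have h := congrArg (fun T : M →L[ℂ] M => T (x k)) hA.star_comm_self.eq
  simpa [bilateralShift_apply, ContinuousLinearMap.star_eq_adjoint] using h

theorem bilateralShift_single (A : M →L[ℂ] M) (d k : ℤ) (v : M) :
    bilateralShift A d (lp.single 2 k v) = lp.single 2 (k - d) (A v) := by
  ext j
  rw [bilateralShift_apply]
  by_cases h : j = k - d
  · subst h
    rw [sub_add_cancel, lp.single_apply_self, lp.single_apply_self]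
  · rw [lp.single_apply_ne _ _ _ h, lp.single_apply_ne _ _ _ (fun h' => h (by omega)), map_zero]

end BilateralShift

/-- The vectors `A^n v` need not be orthogonal; placing them, normalised, in the `n`-th coordinate
of `ℓ²(ℤ, M)` makes them orthonormal. Indexing by `ℤ` keeps the ambient shift normal. -/
theorem isSubnormal_weightedShift_of_norm_pow {M : Type} [NormedAddCommGroup M]
    [InnerProductSpace ℂ M] [CompleteSpace M] {l : ShiftWeights} {A : M →L[ℂ] M}
    (hA : IsStarNormal A) {v : M} (h : ∀ n, ‖(A ^ n) v‖ ^ 2 = l.moment n) :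
    IsSubnormal (weightedShift l) := by
  have hpos : ∀ n, 0 < ‖(A ^ n) v‖ := fun n =>
    (norm_nonneg _).lt_of_ne' fun h0 => (l.moment_pos n).ne' (by rw [← h, h0]; norm_num)
  have hwt : ∀ n, ‖(A ^ (n + 1)) v‖ = ‖(A ^ n) v‖ * l.wt n := fun n => by
    refine (sq_eq_sq₀ (norm_nonneg _) (mul_pos (hpos n) (l.pos n)).le).1 ?_
    rw [mul_pow, h, h, l.moment_succ]
  set u : ℕ → lp (fun _ : ℤ => M) 2 := fun n =>
    lp.single 2 (n : ℤ) ((‖(A ^ n) v‖ : ℂ)⁻¹ • (A ^ n) v) with hu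
  have hu1 : ∀ n, ‖u n‖ = 1 := fun n => by
    rw [hu, lp.norm_single (by norm_num), norm_smul, norm_inv, Complex.norm_real, norm_norm,
      inv_mul_cancel₀ (hpos n).ne']
  have hu0 : ∀ m n, m ≠ n → inner ℂ (u m) (u n) = 0 := fun m n hmn => by
    simp only [hu]
    rw [lp.inner_single_left, lp.single_apply_ne _ _ _ (by exact_mod_cast hmn), inner_zero_right]
  let V : ℕ → ℂ →ₗᵢ[ℂ] lp (fun _ : ℤ => M) 2 := fun n =>
    LinearIsometry.toSpanSingleton ℂ _ (hu1 n)
  have hV : OrthogonalFamily ℂ (fun _ : ℕ => ℂ) V := fun m n hmn a b => by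
    simp [V, inner_smul_left, inner_smul_right, hu0 m n hmn]
  have hVs : ∀ n, hV.linearIsometry (lp.single 2 n 1) = u n := fun n => by
    rw [hV.linearIsometry_apply_single]
    simp [V]
  refine ⟨_, _, inferInstance, inferInstance, hV.linearIsometry, bilateralShift A (-1),
    isStarNormal_bilateralShift hA _, fun x => ?_⟩
  have key : hV.linearIsometry.toContinuousLinearMap ∘L weightedShift l
      = bilateralShift A (-1) ∘L hV.linearIsometry.toContinuousLinearMap := by
    refine EllTwo.clm_ext fun n => ?_
    simp only [ContinuousLinearMap.comp_apply, weightedShift_single, map_smul,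
      LinearIsometry.coe_toContinuousLinearMap, hVs]
    rw [hu, bilateralShift_single, ← lp.single_smul, sub_neg_eq_add,
      Nat.cast_succ]
    congr 1
    rw [map_smul, ← mul_apply_eq_comp, ← pow_succ', smul_smul, hwt]
    congr 1
    have h1 := Complex.ofReal_ne_zero.2 (l.pos n).ne'
    have h2 := Complex.ofReal_ne_zero.2 (hpos n).ne'
    push_cast
    field_simp
  exact congrArg (fun T => T x) key

theorem isSubnormal_unilateralShift : IsSubnormal unilateralShift :=
  isSubnormal_weightedShift_of_norm_pow (M := ℂ) (A := 1) (v := 1) inferInstance fun n => by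
    simp [ShiftWeights.moment, oneWeights]

theorem norm_unilateralShift_le_one : ‖unilateralShift‖ ≤ 1 :=
  norm_weightedShift_le _ fun _ => le_rfl

/-! ### The Hilbert space of a moment functional -/

namespace MomentFunctional

open Polynomial

/-- The polynomial with conjugate coefficients. -/
noncomputable def pconj : ℂ[X] →+* ℂ[X] := mapRingHom (starRingEnd ℂ)

theorem pconj_pconj (p : ℂ[X]) : pconj (pconj p) = p := by
  ext n; simp [pconj]

theorem pconj_C (a : ℂ) : pconj (C a) = C (conj a) := by simp [pconj]

theorem pconj_X : pconj X = X := by simp [pconj]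

theorem pconj_smul (a : ℂ) (p : ℂ[X]) : pconj (a • p) = conj a • pconj p := by
  rw [smul_eq_C_mul, map_mul, pconj_C, smul_eq_C_mul]

/-- The semi-inner product `⟨p, q⟩ = L (p̄ q)` of a positive real functional `L` on polynomials. -/
@[reducible]
noncomputable def core (L : ℂ[X] →ₗ[ℂ] ℂ) (hreal : ∀ p, L (pconj p) = conj (L p))
    (hpos : ∀ p, 0 ≤ L (pconj p * p)) : PreInnerProductSpace.Core ℂ ℂ[X] where
  inner p q := L (pconj p * q)
  conj_inner_symm p q := by rw [← hreal, map_mul, pconj_pconj, mul_comm]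
  re_inner_nonneg p := (RCLike.nonneg_iff.1 (hpos p)).1
  add_left p q r := by rw [map_add, add_mul, map_add]
  smul_left p q a := by rw [pconj_smul, smul_mul_assoc, map_smul, smul_eq_mul]

/-- GNS construction: `B` is multiplication by `X` and `v` is the class of 1. -/
theorem exists_clm (L : ℂ[X] →ₗ[ℂ] ℂ) (hreal : ∀ p, L (pconj p) = conj (L p))
    (h00 : ∀ p, 0 ≤ L (pconj p * p)) (h10 : ∀ p, 0 ≤ L (X * (pconj p * p)))
    (h01 : ∀ p, 0 ≤ L ((1 - X) * (pconj p * p)))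
    (h11 : ∀ p, 0 ≤ L (X * ((1 - X) * (pconj p * p)))) :
    ∃ (M : Type) (_ : NormedAddCommGroup M) (_ : InnerProductSpace ℂ M) (_ : CompleteSpace M)
      (B : M →L[ℂ] M) (v : M), 0 ≤ B ∧ ∀ n, inner ℂ v ((B ^ n) v) = L (X ^ n) := by
  let _ : SeminormedAddCommGroup ℂ[X] :=
    InnerProductSpace.Core.toSeminormedAddCommGroup (c := core L hreal h00)
  let _ : InnerProductSpace ℂ ℂ[X] := InnerProductSpace.ofCore (core L hreal h00)
  have inner_def : ∀ p q : ℂ[X], inner ℂ p q = L (pconj p * q) := fun _ _ => rfl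
  have hbound : ∀ p : ℂ[X], ‖X * p‖ ≤ 1 * ‖p‖ := fun p => by
    rw [one_mul]
    refine le_of_sq_le_sq ?_ (norm_nonneg _)
    rw [← inner_self_eq_norm_sq (𝕜 := ℂ), ← inner_self_eq_norm_sq (𝕜 := ℂ), inner_def, inner_def]
    have h1 := (RCLike.nonneg_iff.1 (h01 p)).1
    have h2 := (RCLike.nonneg_iff.1 (h11 p)).1
    -- Contractivity comes from `1 - x^2 = (1 - x) + x (1 - x)`.
    have e : pconj p * p = (1 - X) * (pconj p * p) + X * ((1 - X) * (pconj p * p))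
      + pconj (X * p) * (X * p) := by
      rw [map_mul, pconj_X]; ring
    rw [e, map_add, map_add, map_add, map_add]
    linarith
  let T : ℂ[X] →L[ℂ] ℂ[X] := (LinearMap.mulLeft ℂ (X : ℂ[X])).mkContinuous 1 hbound
  have hT : ∀ p, T p = X * p := fun _ => rfl
  refine ⟨UniformSpace.Completion ℂ[X], inferInstance, inferInstance, inferInstance,
    T.completion, ((1 : ℂ[X]) : UniformSpace.Completion ℂ[X]), ?_, fun n => ?_⟩
  · rw [ContinuousLinearMap.nonneg_iff_isPositive, ContinuousLinearMap.isPositive_iff]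
    refine ⟨fun x y => ?_, fun x => ?_⟩
    · simp only [ContinuousLinearMap.coe_coe]
      induction x, y using UniformSpace.Completion.induction_on₂ with
      | hp => apply isClosed_eq <;> fun_prop
      | ih p q =>
        simp only [ContinuousLinearMap.completion_apply_coe, UniformSpace.Completion.inner_coe,
          inner_def, hT, map_mul, pconj_X]
        congr 1; ring
    · induction x using UniformSpace.Completion.induction_on with
      | hp => exact isClosed_le continuous_const (by fun_prop)
      | ih p =>
        simp only [ContinuousLinearMap.completion_apply_coe, UniformSpace.Completion.inner_coe,
          inner_def, hT, map_mul, pconj_X]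
        rw [mul_assoc]
        exact h10 p
  · have : (T.completion ^ n) ((1 : ℂ[X]) : UniformSpace.Completion ℂ[X])
        = ((X ^ n : ℂ[X]) : UniformSpace.Completion ℂ[X]) := by
      induction n with
      | zero => simp
      | succ n ih =>
        rw [pow_succ', mul_apply_eq_comp, ih,
          ContinuousLinearMap.completion_apply_coe, hT, ← pow_succ']
    rw [this, UniformSpace.Completion.inner_coe, inner_def, map_one, one_mul]

end MomentFunctional

/-! ### Functionals given by a moment sequence -/

namespace MomentFunctional

open Polynomial Filter Topology

/-- The linear functional on polynomials with moments `γ`. -/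
noncomputable def ofMoments (γ : ℕ → ℝ) : ℂ[X] →ₗ[ℂ] ℂ :=
  lsum fun n => (γ n : ℂ) • LinearMap.id

theorem ofMoments_C_mul_X_pow (γ : ℕ → ℝ) (a : ℂ) (n : ℕ) :
    ofMoments γ (C a * X ^ n) = γ n * a := by
  rw [C_mul_X_pow_eq_monomial, ofMoments, lsum_apply, sum_monomial_index] <;> simp

theorem ofMoments_X_pow (γ : ℕ → ℝ) (n : ℕ) : ofMoments γ (X ^ n) = γ n := by
  simpa using ofMoments_C_mul_X_pow γ 1 n

theorem ofMoments_pconj (γ : ℕ → ℝ) (p : ℂ[X]) :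
    ofMoments γ (pconj p) = conj (ofMoments γ p) := by
  induction p using Polynomial.induction_on' with
  | add p q hp hq => rw [map_add, map_add, hp, hq, map_add, map_add]
  | monomial n a =>
    rw [← C_mul_X_pow_eq_monomial, map_mul, map_pow, pconj_C, pconj_X, ofMoments_C_mul_X_pow,
      ofMoments_C_mul_X_pow, map_mul, Complex.conj_ofReal]

theorem ofMoments_X_pow_mul_pconj_mul (γ : ℕ → ℝ) (m : ℕ) (p : ℂ[X]) :
    ofMoments γ (X ^ m * (pconj p * p)) = ∑ i ∈ Finset.range (p.natDegree + 1),
      ∑ j ∈ Finset.range (p.natDegree + 1),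
        (γ (i + j + m) : ℂ) * p.coeff i * conj (p.coeff j) := by
  have h1 : p = ∑ i ∈ Finset.range (p.natDegree + 1), C (p.coeff i) * X ^ i :=
    p.as_sum_range_C_mul_X_pow
  have h2 : pconj p = ∑ j ∈ Finset.range (p.natDegree + 1), C (conj (p.coeff j)) * X ^ j := by
    conv_lhs => rw [h1]
    simp only [map_sum, map_mul, map_pow, pconj_C, pconj_X]
  have h3 : X ^ m * (pconj p * p) = ∑ i ∈ Finset.range (p.natDegree + 1),
      ∑ j ∈ Finset.range (p.natDegree + 1),
        C (p.coeff i * conj (p.coeff j)) * X ^ (i + j + m) := by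
    rw [mul_comm (pconj p), h2]
    conv_lhs => enter [2, 1]; rw [h1]
    rw [Finset.sum_mul_sum, Finset.mul_sum]
    refine Finset.sum_congr rfl fun i _ => ?_
    rw [Finset.mul_sum]
    refine Finset.sum_congr rfl fun j _ => ?_
    rw [C_mul, pow_add, pow_add]
    ring
  rw [h3]
  simp only [map_sum, ofMoments_C_mul_X_pow, mul_assoc]

theorem tendsto_ofMoments_X_pow_mul {γ : ℕ → ℝ} (h : Tendsto γ atTop (𝓝 0)) (r : ℂ[X]) :
    Tendsto (fun m => ofMoments γ (X ^ m * r)) atTop (𝓝 0) := by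
  induction r using Polynomial.induction_on' with
  | add p q hp hq => simpa only [mul_add, map_add, add_zero] using hp.add hq
  | monomial n a =>
    have h1 : ∀ m, ofMoments γ (X ^ m * monomial n a) = γ (m + n) * a := fun m => by
      rw [← C_mul_X_pow_eq_monomial, ← ofMoments_C_mul_X_pow, pow_add]
      congr 1; ring
    simp only [h1]
    have h2 : Tendsto (fun m => (γ (m + n) : ℂ)) atTop (𝓝 ((0 : ℝ) : ℂ)) :=
      (Complex.continuous_ofReal.tendsto 0).comp ((tendsto_add_atTop_iff_nat n).2 h)
    simpa using h2.mul_const a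

/-- The hypothesis says that `m ↦ L (X^m r)` is decreasing; its limit is 0. -/
theorem nonneg_of_one_sub_X_mul_nonneg {γ : ℕ → ℝ} (hγ : Tendsto γ atTop (𝓝 0)) {r : ℂ[X]}
    (h : ∀ m, 0 ≤ ofMoments γ (X ^ m * ((1 - X) * r))) (m : ℕ) :
    0 ≤ ofMoments γ (X ^ m * r) := by
  refine Antitone.le_of_tendsto (antitone_nat_of_succ_le fun n => ?_)
    (tendsto_ofMoments_X_pow_mul hγ r) m
  rw [← sub_nonneg, ← map_sub]
  convert h n using 2
  ring

end MomentFunctional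

/-! ### Conditionally positive definite shifts -/

open Filter Topology in
theorem exists_moment_lower_bound_or_tendsto_zero {γ : ℕ → ℝ} (hpos : ∀ n, 0 < γ n)
    (hconv : ∀ n, γ (n + 1) - γ n ≤ γ (n + 2) - γ (n + 1)) :
    (∃ c, 0 < c ∧ ∀ n, c ≤ γ n) ∨ Tendsto γ atTop (𝓝 0) := by
  by_cases hdec : ∀ n, γ (n + 1) ≤ γ n
  · have hb : BddBelow (Set.range γ) := ⟨0, by rintro _ ⟨n, rfl⟩; exact (hpos n).le⟩
    have ht := tendsto_atTop_ciInf (antitone_nat_of_succ_le hdec) hb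
    rcases (le_ciInf fun n => (hpos n).le : (0 : ℝ) ≤ ⨅ n, γ n).eq_or_lt with h0 | h0
    · right; rwa [← h0] at ht
    · exact Or.inl ⟨_, h0, ciInf_le hb⟩
  · left
    push Not at hdec
    obtain ⟨N, hN⟩ := hdec
    -- Increments never decrease, so after one positive increment the sequence keeps growing and its
    -- minimum lies among the first `N + 1` terms.
    have hinc : ∀ k, γ (N + k) ≤ γ (N + (k + 1)) := by
      have : ∀ k, γ (N + 1) - γ N ≤ γ (N + (k + 1)) - γ (N + k) := fun k => by
        induction k with
        | zero => exact le_rfl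
        | succ k ih => exact ih.trans (hconv (N + k))
      exact fun k => by linarith [this k]
    have hmono : Monotone fun k => γ (N + k) := monotone_nat_of_le_succ hinc
    obtain ⟨i, -, hi⟩ := Finset.exists_min_image (Finset.range (N + 1)) γ ⟨0, by simp⟩
    refine ⟨γ i, hpos i, fun n => ?_⟩
    rcases le_total n N with h | h
    · exact hi n (by simpa using Nat.lt_succ_of_le h)
    · obtain ⟨k, rfl⟩ := Nat.exists_eq_add_of_le h
      exact (hi N (by simp)).trans (hmono k.zero_le)

namespace MomentFunctional

open Polynomial

/-- The zero-sum condition on coefficients is `p(1) = 0`, and testing CPD at `e_m` shifts the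
moments by `m`. -/
theorem nonneg_of_isCPD {l : ShiftWeights} (hl : IsCPD (weightedShift l)) (m : ℕ) {p : ℂ[X]}
    (hp : p.eval 1 = 0) : 0 ≤ ofMoments l.moment (X ^ m * (pconj p * p)) := by
  have hsum : ∑ j ∈ Finset.range (p.natDegree + 1), p.coeff j = 0 := by
    rw [eval_eq_sum_range] at hp
    simpa using hp
  have h := hl (lp.single 2 m 1) p.natDegree p.coeff hsum
  rw [ofMoments_X_pow_mul_pconj_mul]
  have h' := mul_nonneg (Complex.zero_le_real.2 (l.moment_pos m).le) h
  simp only [Finset.mul_sum] at h'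
  refine h'.trans_eq (Finset.sum_congr rfl fun i _ => Finset.sum_congr rfl fun j _ => ?_)
  rw [← moment_mul_norm_sq_weightedShift_pow_single, Complex.ofReal_mul]
  ring

end MomentFunctional

open MomentFunctional Polynomial in
theorem moment_convex_of_isCPD {l : ShiftWeights} (hl : IsCPD (weightedShift l)) (n : ℕ) :
    l.moment (n + 1) - l.moment n ≤ l.moment (n + 2) - l.moment (n + 1) := by
  have h := nonneg_of_isCPD hl n (p := X - 1) (by simp)
  have e : (X : ℂ[X]) ^ n * (pconj (X - 1) * (X - 1))
      = X ^ (n + 2) - X ^ (n + 1) - (X ^ (n + 1) - X ^ n) := by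
    rw [map_sub, map_one, pconj_X]; ring
  rw [e] at h
  simp only [map_sub, ofMoments_X_pow] at h
  rw [← sub_nonneg]
  exact_mod_cast h

open MomentFunctional Polynomial Filter Topology in
theorem isSubnormal_of_isCPD_of_tendsto_zero {l : ShiftWeights} (hl : IsCPD (weightedShift l))
    (h0 : Tendsto l.moment atTop (𝓝 0)) : IsSubnormal (weightedShift l) := by
  have h2 : ∀ (p : ℂ[X]) m,
      0 ≤ ofMoments l.moment (X ^ m * ((1 - X) * ((1 - X) * (pconj p * p)))) := fun p m => by
    convert nonneg_of_isCPD hl m (p := (1 - X) * p) (by simp) using 2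
    rw [map_mul, map_sub, map_one, pconj_X]
    ring
  have h1 := fun p : ℂ[X] => nonneg_of_one_sub_X_mul_nonneg h0 (h2 p)
  have h0' := fun p : ℂ[X] => nonneg_of_one_sub_X_mul_nonneg h0 (h1 p)
  obtain ⟨M, _, _, _, B, v, hB, hv⟩ := exists_clm (ofMoments l.moment) (ofMoments_pconj _)
    (fun p => by simpa using h0' p 0) (fun p => by simpa using h0' p 1)
    (fun p => by simpa using h1 p 0) (fun p => by simpa using h1 p 1)
  -- The square root turns `⟨v, B^n v⟩` into a squared norm `‖A^n v‖^2`.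
  have hA : IsSelfAdjoint (CFC.sqrt B) := (CFC.sqrt_nonneg B).isSelfAdjoint
  refine isSubnormal_weightedShift_of_norm_pow (A := CFC.sqrt B) (v := v) hA.isStarNormal
    fun n => ?_
  have hAn : ContinuousLinearMap.adjoint (CFC.sqrt B ^ n) = CFC.sqrt B ^ n := (hA.pow n).star_eq
  have hsq : CFC.sqrt B ^ n * CFC.sqrt B ^ n = B ^ n := by
    rw [← (Commute.refl (CFC.sqrt B)).mul_pow, CFC.sqrt_mul_sqrt_self B hB]
  rw [← inner_self_eq_norm_sq (𝕜 := ℂ), ← ContinuousLinearMap.adjoint_inner_right, hAn,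
    ← mul_apply_eq_comp, hsq, hv, ofMoments_X_pow]
  simp

theorem isQuasiAffineTransform_of_isCPD_of_not_isSubnormal {l w : ShiftWeights}
    (hl : IsCPD (weightedShift l)) (hns : ¬ IsSubnormal (weightedShift l))
    (hw : ‖weightedShift w‖ ≤ 1) :
    IsQuasiAffineTransform (weightedShift l) (weightedShift w) := by
  rcases exists_moment_lower_bound_or_tendsto_zero l.moment_pos (moment_convex_of_isCPD hl) with
    ⟨c, hc, h⟩ | h
  · refine isQuasiAffineTransform_of_moment_le (C := c⁻¹) fun n => ?_
    refine (w.moment_le_one hw n).trans ?_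
    rw [← inv_mul_cancel₀ hc.ne']
    exact mul_le_mul_of_nonneg_left (h n) (inv_pos.2 hc).le
  · exact absurd (isSubnormal_of_isCPD_of_tendsto_zero hl h) hns

theorem proposition2p11 :
    -- a non-subnormal CPD shift is a quasi-affine transform of every contractive subnormal shift
    (∀ l : ShiftWeights, IsCPD (weightedShift l) → ¬ IsSubnormal (weightedShift l) →
      (∀ w : ShiftWeights, IsSubnormal (weightedShift w) → ‖weightedShift w‖ ≤ 1 →
        IsQuasiAffineTransform (weightedShift l) (weightedShift w)) ∧
      IsQuasiAffineTransform (weightedShift l) unilateralShift) ∧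
    -- the unilateral shift is one of these contractive subnormal shifts
    (IsSubnormal unilateralShift ∧ ‖unilateralShift‖ ≤ 1) ∧
    -- a subnormal shift of type I or type II has norm one
    (∀ l : ShiftWeights, IsSubnormal (weightedShift l) → (l.IsTypeI ∨ l.IsTypeII) →
      ‖weightedShift l‖ = 1) :=
  ⟨fun _ hl hns =>
    ⟨fun _ _ hw => isQuasiAffineTransform_of_isCPD_of_not_isSubnormal hl hns hw,
      isQuasiAffineTransform_of_isCPD_of_not_isSubnormal hl hns norm_unilateralShift_le_one⟩,
    ⟨isSubnormal_unilateralShift, norm_unilateralShift_le_one⟩,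
    fun _ hl ht => norm_weightedShift_eq_one_of_type hl ht⟩
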